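/- Fix a first-order language with equality, with arbitrary function and relation symbols and countably infinitely many parameters (free variables); its formulas (taken up to renaming of bound variables) are built from atomic formulas (relational atoms and equations) and $\bot$ by $\wedge,\vee,\rightarrow,\forall,\exists$. A sequent $\Gamma\Rightarrow\Delta$ consists of two finite multisets of formulas. Below $P$ is atomic, $A,B$ are arbitrary formulas, $s,r,t$ are arbitrary terms, and $a$ is a parameter that does not occur in the conclusion of the rule. The calculus $\mathbf{G3c}$ has the initial sequents $P,\Gamma\Rightarrow\Delta,P$ and the following rules (premisses before the slash, conclusion after it): - $L\bot$: $\;/\;\bot,\Gamma\Rightarrow\Delta$ (no premiss). - $L\wedge$: $A,B,\Gamma\Rightarrow\Delta\;/\;A\wedge B,\Gamma\Rightarrow\Delta$. $\quad R\wedge$: $\Gamma\Rightarrow\Delta,A$ and $\Gamma\Rightarrow\Delta,B\;/\;\Gamma\Rightarrow\Delta,A\wedge B$. - $L\vee$: $A,\Gamma\Rightarrow\Delta$ and $B,\Gamma\Rightarrow\Delta\;/\;A\vee B,\Gamma\Rightarrow\Delta$. $\quad R\vee$: $\Gamma\Rightarrow\Delta,A,B\;/\;\Gamma\Rightarrow\Delta,A\vee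 B$. - $L{\rightarrow}$: $\Gamma\Rightarrow\Delta,A$ and $B,\Gamma\Rightarrow\Delta\;/\;A\rightarrow B,\Gamma\Rightarrow\Delta$. $\quad R{\rightarrow}$: $A,\Gamma\Rightarrow\Delta,B\;/\;\Gamma\Rightarrow\Delta,A\rightarrow B$. - $L\forall$: $A[x/t],\forall xA,\Gamma\Rightarrow\Delta\;/\;\forall xA,\Gamma\Rightarrow\Delta$. $\quad R\forall$: $\Gamma\Rightarrow\Delta,A[x/a]\;/\;\Gamma\Rightarrow\Delta,\forall xA$. - $L\exists$: $A[x/a],\Gamma\Rightarrow\Delta\;/\;\exists xA,\Gamma\Rightarrow\Delta$. $\quad R\exists$: $\Gamma\Rightarrow\Delta,\exists xA,A[x/t]\;/\;\Gamma\Rightarrow\Delta,\exists xA$. $\mathbf{G3i}$ is obtained from $\mathbf{G3c}$ by replacing $L{\rightarrow}$, $R{\rightarrow}$, $R\forall$ with - $L^i{\rightarrow}$: $A\rightarrow B,\Gamma\Rightarrow\Delta,A$ and $B,\Gamma\Rightarrow\Delta\;/\;A\rightarrow B,\Gamma\Rightarrow\Delta$; - $R^i{\rightarrow}$: $A,\Gamma\Rightarrow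 B\;/\;\Gamma\Rightarrow\Delta,A\rightarrow B$; - $R^i\forall$: $\Gamma\Rightarrow A[x/a]\;/\;\Gamma\Rightarrow\Delta,\forall xA$. $\mathbf{G3m}$ is obtained from $\mathbf{G3i}$ by replacing $L\bot$ with the initial sequents $\bot,\Gamma\Rightarrow\Delta,\bot$. For each of these three calculi let $\mathbf{G3[mic]}^{=}$ be the calculus obtained by adding the equality rules, for arbitrary terms $s,r,t$ and arbitrary atomic $P$: - $\mathrm{Ref}$: $t=t,\Gamma\Rightarrow\Delta\;/\;\Gamma\Rightarrow\Delta$; - $\mathrm{Repl}$: $s=r,P[x/s],P[x/r],\Gamma\Rightarrow\Delta\;/\;s=r,P[x/s],\Gamma\Rightarrow\Delta$. **Corollary.** In each of the three calculi $\mathbf{G3[mic]}^{=}$ the structural rules are admissible, i.e. whenever the premisses of an instance of one of the following rules are derivable, so is its conclusion ($A$ any formula; $\Gamma,\Delta,\Lambda,\Theta$ any finite multisets of formulas): - left weakening $\Gamma\Rightarrow\Delta\;/\;A,\Gamma\Rightarrow\Delta$ and right weakening $\Gamma\Rightarrow\Delta\;/\;\Gamma\Rightarrow\Delta,A$; - left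 contraction $A,A,\Gamma\Rightarrow\Delta\;/\;A,\Gamma\Rightarrow\Delta$ and right contraction $\Gamma\Rightarrow\Delta,A,A\;/\;\Gamma\Rightarrow\Delta,A$; - cut: $\Gamma\Rightarrow\Delta,A$ and $A,\Lambda\Rightarrow\Theta\;/\;\Gamma,\Lambda\Rightarrow\Delta,\Theta$. -/

import Mathlib

universe u v

namespace G3

/-- Terms of the language `L` over the free variables (parameters) `ℕ` and `n` bound variables. -/
abbrev Tm (L : FirstOrder.Language.{u, v}) (n : ℕ) : Type u := L.Term (ℕ ⊕ Fin n)

/-- First-order formulas with equality, up to renaming of bound variables: parameters are named by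
`ℕ`, bound variables are well-scoped de Bruijn indices (`0` is bound by the innermost quantifier).
`Fml L 0` are the formulas proper; an `A : Fml L 1` is a formula with a distinguished variable `x`
that may be substituted for. All six logical constants are primitive. -/
inductive Fml (L : FirstOrder.Language.{u, v}) : ℕ → Type (max u v)
  | rel {n k : ℕ} (R : L.Relations k) (ts : Fin k → Tm L n) : Fml L n
  | eq {n : ℕ} (s t : Tm L n) : Fml L n
  | bot {n : ℕ} : Fml L n
  | and {n : ℕ} (A B : Fml L n) : Fml L n
  | or {n : ℕ} (A B : Fml L n) : Fml L n
  | imp {n : ℕ} (A B : Fml L n) : Fml L n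
  | all {n : ℕ} (A : Fml L (n + 1)) : Fml L n
  | ex {n : ℕ} (A : Fml L (n + 1)) : Fml L n

variable {L : FirstOrder.Language.{u, v}}

/-- A substitution carried under one quantifier: the newly bound variable is left alone. -/
def liftSubst {n m : ℕ} (σ : ℕ ⊕ Fin n → Tm L m) : ℕ ⊕ Fin (n + 1) → Tm L (m + 1) :=
  Sum.elim
    (fun a => (σ (Sum.inl a)).relabel (Sum.map id Fin.succ))
    (Fin.cases (FirstOrder.Language.Term.var (Sum.inr 0))
      (fun i => (σ (Sum.inr i)).relabel (Sum.map id Fin.succ)))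

/-- Simultaneous capture-avoiding substitution of terms for parameters and bound variables. -/
def Fml.subst : {n : ℕ} → Fml L n → {m : ℕ} → (ℕ ⊕ Fin n → Tm L m) → Fml L m
  | _, .rel R ts, _, σ => .rel R (fun i => (ts i).subst σ)
  | _, .eq s t, _, σ => .eq (s.subst σ) (t.subst σ)
  | _, .bot, _, _ => .bot
  | _, .and A B, _, σ => .and (A.subst σ) (B.subst σ)
  | _, .or A B, _, σ => .or (A.subst σ) (B.subst σ)
  | _, .imp A B, _, σ => .imp (A.subst σ) (B.subst σ)
  | _, .all A, _, σ => .all (A.subst (liftSubst σ))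
  | _, .ex A, _, σ => .ex (A.subst (liftSubst σ))

/-- `A.inst t` is `A[x/t]`, where `x` is the distinguished variable of `A`. -/
def Fml.inst (A : Fml L 1) (t : Tm L 0) : Fml L 0 :=
  A.subst (Sum.elim (fun a => FirstOrder.Language.Term.var (Sum.inl a)) (fun _ => t))

/-- The parameter `a` as a term. -/
def par (a : ℕ) : Tm L 0 := FirstOrder.Language.Term.var (Sum.inl a)

/-- The parameters occurring in a formula. -/
def Fml.params : {n : ℕ} → Fml L n → Finset ℕ
  | _, .rel _ ts => Finset.univ.biUnion (fun i => (ts i).varFinsetLeft)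
  | _, .eq s t => s.varFinsetLeft ∪ t.varFinsetLeft
  | _, .bot => ∅
  | _, .and A B => A.params ∪ B.params
  | _, .or A B => A.params ∪ B.params
  | _, .imp A B => A.params ∪ B.params
  | _, .all A => A.params
  | _, .ex A => A.params

/-- Atomic formulas: relational atoms and equations (`⊥` is not atomic). -/
inductive Fml.IsAtomic : {n : ℕ} → Fml L n → Prop
  | rel {n k : ℕ} (R : L.Relations k) (ts : Fin k → Tm L n) : Fml.IsAtomic (Fml.rel R ts)
  | eq {n : ℕ} (s t : Tm L n) : Fml.IsAtomic (Fml.eq s t)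

/-- Sequents: pairs of finite multisets of formulas. -/
structure Sequent (L : FirstOrder.Language.{u, v}) where
  ant : Multiset (Fml L 0)
  suc : Multiset (Fml L 0)

infix:45 " ⇒ " => Sequent.mk

/-- The parameter `a` does not occur in the sequent. -/
def Sequent.Fresh (a : ℕ) (S : Sequent L) : Prop :=
  (∀ B ∈ S.ant, a ∉ B.params) ∧ (∀ B ∈ S.suc, a ∉ B.params)

/-- A rule (or a set of rules) is given by its instances: `ρ ps c` says that `c` may be inferred
from the list of premisses `ps`. Initial sequents are rules without premisses. -/
abbrev Rules (L : FirstOrder.Language.{u, v}) : Type (max u v) := List (Sequent L) → Sequent L → Prop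

/-- Derivability in the sequent calculus with the given rules. -/
inductive Derivable (C : Rules L) : Sequent L → Prop
  | infer {ps : List (Sequent L)} {c : Sequent L} (h : C ps c)
      (d : ∀ p ∈ ps, Derivable C p) : Derivable C c

/-- The rule `ρ` is admissible in the calculus `C`: the sequents derivable in `C` are closed
under `ρ`. -/
def Admissible (C ρ : Rules L) : Prop :=
  ∀ ps c, ρ ps c → (∀ p ∈ ps, Derivable C p) → Derivable C c

/-- Minimal, intuitionistic and classical logic. -/
inductive Logic
  | m
  | i
  | c

/-- The initial sequents and the logical rules of `G3m`, `G3i` and `G3c`. -/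
inductive G3mic (L : FirstOrder.Language.{u, v}) : Logic → Rules L
  | init (l : Logic) (P : Fml L 0) (hP : P.IsAtomic) (Γ Δ : Multiset (Fml L 0)) :
      G3mic L l [] (P ::ₘ Γ ⇒ P ::ₘ Δ)
  | botInit (Γ Δ : Multiset (Fml L 0)) :
      G3mic L .m [] (.bot ::ₘ Γ ⇒ .bot ::ₘ Δ)
  | botL (l : Logic) (hl : l ≠ .m) (Γ Δ : Multiset (Fml L 0)) :
      G3mic L l [] (.bot ::ₘ Γ ⇒ Δ)
  | andL (l : Logic) (A B : Fml L 0) (Γ Δ : Multiset (Fml L 0)) :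
      G3mic L l [A ::ₘ B ::ₘ Γ ⇒ Δ] (.and A B ::ₘ Γ ⇒ Δ)
  | andR (l : Logic) (A B : Fml L 0) (Γ Δ : Multiset (Fml L 0)) :
      G3mic L l [Γ ⇒ A ::ₘ Δ, Γ ⇒ B ::ₘ Δ] (Γ ⇒ .and A B ::ₘ Δ)
  | orL (l : Logic) (A B : Fml L 0) (Γ Δ : Multiset (Fml L 0)) :
      G3mic L l [A ::ₘ Γ ⇒ Δ, B ::ₘ Γ ⇒ Δ] (.or A B ::ₘ Γ ⇒ Δ)
  | orR (l : Logic) (A B : Fml L 0) (Γ Δ : Multiset (Fml L 0)) :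
      G3mic L l [Γ ⇒ A ::ₘ B ::ₘ Δ] (Γ ⇒ .or A B ::ₘ Δ)
  | impL (A B : Fml L 0) (Γ Δ : Multiset (Fml L 0)) :
      G3mic L .c [Γ ⇒ A ::ₘ Δ, B ::ₘ Γ ⇒ Δ] (.imp A B ::ₘ Γ ⇒ Δ)
  | impR (A B : Fml L 0) (Γ Δ : Multiset (Fml L 0)) :
      G3mic L .c [A ::ₘ Γ ⇒ B ::ₘ Δ] (Γ ⇒ .imp A B ::ₘ Δ)
  | impLi (l : Logic) (hl : l ≠ .c) (A B : Fml L 0) (Γ Δ : Multiset (Fml L 0)) :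
      G3mic L l [.imp A B ::ₘ Γ ⇒ A ::ₘ Δ, B ::ₘ Γ ⇒ Δ] (.imp A B ::ₘ Γ ⇒ Δ)
  | impRi (l : Logic) (hl : l ≠ .c) (A B : Fml L 0) (Γ Δ : Multiset (Fml L 0)) :
      G3mic L l [A ::ₘ Γ ⇒ {B}] (Γ ⇒ .imp A B ::ₘ Δ)
  | allL (l : Logic) (A : Fml L 1) (t : Tm L 0) (Γ Δ : Multiset (Fml L 0)) :
      G3mic L l [A.inst t ::ₘ .all A ::ₘ Γ ⇒ Δ] (.all A ::ₘ Γ ⇒ Δ)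
  | allR (A : Fml L 1) (a : ℕ) (Γ Δ : Multiset (Fml L 0))
      (ha : (Γ ⇒ .all A ::ₘ Δ).Fresh a) :
      G3mic L .c [Γ ⇒ A.inst (par a) ::ₘ Δ] (Γ ⇒ .all A ::ₘ Δ)
  | allRi (l : Logic) (hl : l ≠ .c) (A : Fml L 1) (a : ℕ) (Γ Δ : Multiset (Fml L 0))
      (ha : (Γ ⇒ .all A ::ₘ Δ).Fresh a) :
      G3mic L l [Γ ⇒ {A.inst (par a)}] (Γ ⇒ .all A ::ₘ Δ)
  | exL (l : Logic) (A : Fml L 1) (a : ℕ) (Γ Δ : Multiset (Fml L 0))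
      (ha : (.ex A ::ₘ Γ ⇒ Δ).Fresh a) :
      G3mic L l [A.inst (par a) ::ₘ Γ ⇒ Δ] (.ex A ::ₘ Γ ⇒ Δ)
  | exR (l : Logic) (A : Fml L 1) (t : Tm L 0) (Γ Δ : Multiset (Fml L 0)) :
      G3mic L l [Γ ⇒ A.inst t ::ₘ .ex A ::ₘ Δ] (Γ ⇒ .ex A ::ₘ Δ)

/-- The equality rules `Ref` and `Repl`, for arbitrary terms and an arbitrary atomic `P`. -/
inductive EqRules (L : FirstOrder.Language.{u, v}) : Rules L
  | ref (t : Tm L 0) (Γ Δ : Multiset (Fml L 0)) :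
      EqRules L [.eq t t ::ₘ Γ ⇒ Δ] (Γ ⇒ Δ)
  | repl (s r : Tm L 0) (P : Fml L 1) (hP : P.IsAtomic) (Γ Δ : Multiset (Fml L 0)) :
      EqRules L [.eq s r ::ₘ P.inst s ::ₘ P.inst r ::ₘ Γ ⇒ Δ] (.eq s r ::ₘ P.inst s ::ₘ Γ ⇒ Δ)

/-- The calculus obtained from `G3m`, `G3i` or `G3c` by adding the rules in `R`. -/
def G3With (l : Logic) (R : Rules L) : Rules L := fun ps c => G3mic L l ps c ∨ R ps c

/-- The calculus `G3m`, `G3i` or `G3c` with the equality rules. -/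
def G3Eq (L : FirstOrder.Language.{u, v}) (l : Logic) : Rules L := G3With l (EqRules L)

/-- Left weakening. -/
inductive LW (L : FirstOrder.Language.{u, v}) : Rules L
  | mk (A : Fml L 0) (Γ Δ : Multiset (Fml L 0)) : LW L [Γ ⇒ Δ] (A ::ₘ Γ ⇒ Δ)

/-- Right weakening. -/
inductive RW (L : FirstOrder.Language.{u, v}) : Rules L
  | mk (A : Fml L 0) (Γ Δ : Multiset (Fml L 0)) : RW L [Γ ⇒ Δ] (Γ ⇒ A ::ₘ Δ)

/-- Left contraction. -/
inductive LC (L : FirstOrder.Language.{u, v}) : Rules L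
  | mk (A : Fml L 0) (Γ Δ : Multiset (Fml L 0)) : LC L [A ::ₘ A ::ₘ Γ ⇒ Δ] (A ::ₘ Γ ⇒ Δ)

/-- Right contraction. -/
inductive RC (L : FirstOrder.Language.{u, v}) : Rules L
  | mk (A : Fml L 0) (Γ Δ : Multiset (Fml L 0)) : RC L [Γ ⇒ A ::ₘ A ::ₘ Δ] (Γ ⇒ A ::ₘ Δ)

/-- Cut, with independent contexts. -/
inductive Cut (L : FirstOrder.Language.{u, v}) : Rules L
  | mk (A : Fml L 0) (Γ Δ Λ Θ : Multiset (Fml L 0)) :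
      Cut L [Γ ⇒ A ::ₘ Δ, A ::ₘ Λ ⇒ Θ] (Γ + Λ ⇒ Δ + Θ)

end G3

/-! The multiset calculus is compared with a cumulative one, `CDer`, whose sequents are pairs of
sets, whose premisses keep all principal formulas, and whose eigenvariable rules have a premiss for
every term. There weakening is monotonicity (`CDer.mono`), contraction is built in, and no freshness
condition interferes with substitution.

Cut for `CDer` goes by induction on the size of the cut formula, then on the derivation of the left
premiss. `Ref` and `Repl` act on antecedents only, so they commute with removing the cut formula
from a succedent; an atomic cut formula is principal on the right only in an axiom, and the cut is
then trivial. For a compound cut formula principal on the right, the other premiss is inverted (`∧`,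
`∨`, `∃`) or examined by a second induction (`→`, `∀`).

The two calculi derive the same sequents (`derivable_iff_cder`). One direction proves all
substitution instances at once. The other must recover derivations in which principal formulas may
be consumed; it strengthens the claim to every multiset sequent that "covers" the set sequent, which
incorporates inversion of the invertible rules. The remaining obstacle is a `Repl` whose two
principal formulas are one occurrence; `of_repl_self` simulates it by other equality inferences. -/

namespace G3

variable {L : FirstOrder.Language.{u, v}}

/-! ### Substitution -/

theorem liftSubst_comp {n m k : ℕ} (σ : ℕ ⊕ Fin n → Tm L m) (τ : ℕ ⊕ Fin m → Tm L k) :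
    (fun x => (liftSubst σ x).subst (liftSubst τ)) = liftSubst (fun x => (σ x).subst τ) := by
  have key : ∀ t : Tm L m, (t.relabel (Sum.map id Fin.succ)).subst (liftSubst τ) =
      (t.subst τ).relabel (Sum.map id Fin.succ) := by
    intro t
    induction t with
    | var x => rcases x with a | i <;> rfl
    | func f ts ih =>
      simp only [FirstOrder.Language.Term.relabel, FirstOrder.Language.Term.subst, ih]
  funext x
  rcases x with a | i
  · exact key _
  · refine Fin.cases rfl (fun i => ?_) i
    exact key _

theorem Term.subst_subst {α β γ : Type*} (t : L.Term α) (σ : α → L.Term β) (τ : β → L.Term γ) :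
    (t.subst σ).subst τ = t.subst (fun x => (σ x).subst τ) := by
  induction t with
  | var x => rfl
  | func f ts ih => simp only [FirstOrder.Language.Term.subst, ih]

theorem Fml.subst_subst {n : ℕ} (A : Fml L n) {m k : ℕ} (σ : ℕ ⊕ Fin n → Tm L m)
    (τ : ℕ ⊕ Fin m → Tm L k) : (A.subst σ).subst τ = A.subst (fun x => (σ x).subst τ) := by
  induction A generalizing m k with
  | rel | eq => simp only [Fml.subst, Term.subst_subst]
  | bot => rfl
  | and A B ihA ihB | or A B ihA ihB | imp A B ihA ihB => simp only [Fml.subst, ihA, ihB]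
  | all A ih | ex A ih => simp only [Fml.subst, ih, liftSubst_comp]

theorem Term.subst_congr {n m : ℕ} (t : Tm L n) {σ τ : ℕ ⊕ Fin n → Tm L m}
    (hp : ∀ a ∈ t.varFinsetLeft, σ (.inl a) = τ (.inl a)) (hb : ∀ i, σ (.inr i) = τ (.inr i)) :
    t.subst σ = t.subst τ := by
  induction t with
  | var x =>
    rcases x with a | i
    · exact hp a (by simp [FirstOrder.Language.Term.varFinsetLeft])
    · exact hb i
  | func f ts ih =>
    simp only [FirstOrder.Language.Term.subst]
    congr 1
    funext i
    refine ih i (fun a ha => hp a ?_)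
    simp only [FirstOrder.Language.Term.varFinsetLeft, Finset.mem_biUnion]
    exact ⟨i, Finset.mem_univ _, ha⟩

theorem liftSubst_congr {n m : ℕ} {σ τ : ℕ ⊕ Fin n → Tm L m} (S : Finset ℕ)
    (hp : ∀ a ∈ S, σ (.inl a) = τ (.inl a)) (hb : ∀ i, σ (.inr i) = τ (.inr i)) :
    (∀ a ∈ S, liftSubst σ (.inl a) = liftSubst τ (.inl a)) ∧
      ∀ i, liftSubst σ (.inr i) = liftSubst τ (.inr i) := by
  refine ⟨fun a ha => ?_, fun i => ?_⟩
  · simp [liftSubst, hp a ha]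
  · refine Fin.cases rfl (fun i => ?_) i
    simp [liftSubst, hb i]

theorem Fml.subst_congr {n : ℕ} (A : Fml L n) {m : ℕ} {σ τ : ℕ ⊕ Fin n → Tm L m}
    (hp : ∀ a ∈ A.params, σ (.inl a) = τ (.inl a)) (hb : ∀ i, σ (.inr i) = τ (.inr i)) :
    A.subst σ = A.subst τ := by
  induction A generalizing m with
  | rel R ts =>
    simp only [Fml.subst]
    congr 1
    funext i
    refine Term.subst_congr _ (fun a ha => hp a ?_) hb
    simp only [Fml.params, Finset.mem_biUnion]
    exact ⟨i, Finset.mem_univ _, ha⟩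
  | eq s t =>
    simp only [Fml.params, Finset.mem_union] at hp
    simp only [Fml.subst, Term.subst_congr s (fun a ha => hp a (.inl ha)) hb,
      Term.subst_congr t (fun a ha => hp a (.inr ha)) hb]
  | bot => rfl
  | and A B ihA ihB | or A B ihA ihB | imp A B ihA ihB =>
    simp only [Fml.params, Finset.mem_union] at hp
    simp only [Fml.subst, ihA (fun a ha => hp a (.inl ha)) hb,
      ihB (fun a ha => hp a (.inr ha)) hb]
  | all A ih | ex A ih =>
    obtain ⟨h1, h2⟩ := liftSubst_congr A.params hp hb
    simp only [Fml.subst, ih h1 h2]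

theorem liftSubst_var {n : ℕ} :
    liftSubst (FirstOrder.Language.Term.var : ℕ ⊕ Fin n → Tm L n) =
      FirstOrder.Language.Term.var := by
  funext x
  rcases x with a | i
  · rfl
  · exact Fin.cases rfl (fun _ => rfl) i

theorem Term.subst_var {α : Type*} (t : L.Term α) : t.subst FirstOrder.Language.Term.var = t := by
  induction t with
  | var x => rfl
  | func f ts ih => simp only [FirstOrder.Language.Term.subst, ih]

theorem Fml.subst_var {n : ℕ} (A : Fml L n) : A.subst FirstOrder.Language.Term.var = A := by
  induction A with
  | rel | eq => simp only [Fml.subst, Term.subst_var]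
  | bot => rfl
  | and A B ihA ihB | or A B ihA ihB | imp A B ihA ihB => simp only [Fml.subst, ihA, ihB]
  | all A ih | ex A ih => simp only [Fml.subst, liftSubst_var, ih]

theorem Fml.IsAtomic.subst {n m : ℕ} {A : Fml L n} (h : A.IsAtomic) (σ : ℕ ⊕ Fin n → Tm L m) :
    (A.subst σ).IsAtomic := by
  cases h with
  | rel => exact .rel _ _
  | eq => exact .eq _ _

/-- The substitution of the term `t` for the distinguished variable. -/
def instSubst (t : Tm L 0) : ℕ ⊕ Fin 1 → Tm L 0 :=
  Sum.elim (fun a => FirstOrder.Language.Term.var (Sum.inl a)) (fun _ => t)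

theorem Fml.inst_eq (A : Fml L 1) (t : Tm L 0) : A.inst t = A.subst (instSubst t) := rfl

/-- The term `t` seen as a term in which the distinguished variable does not
occur. -/
def Term.weaken (t : Tm L 0) : Tm L 1 := t.relabel (Sum.map id Fin.succ)

theorem Term.weaken_subst (s t : Tm L 0) : (Term.weaken s).subst (instSubst t) = s := by
  unfold Term.weaken
  induction s with
  | var x => rcases x with a | i <;> [rfl; exact i.elim0]
  | func f ts ih =>
    simp only [FirstOrder.Language.Term.relabel, FirstOrder.Language.Term.subst, ih]

theorem Fml.inst_subst (A : Fml L 1) (t : Tm L 0) (σ : ℕ ⊕ Fin 0 → Tm L 0) :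
    (A.inst t).subst σ = (A.subst (liftSubst σ)).inst (t.subst σ) := by
  rw [Fml.inst_eq, Fml.inst_eq, Fml.subst_subst, Fml.subst_subst]
  refine congrArg A.subst (funext fun x => ?_)
  rcases x with a | i
  · exact (Term.weaken_subst _ _).symm
  · rw [Subsingleton.elim i 0]
    rfl

/-- The substitution `σ` changed to `t` at the parameter `a`. -/
def updateParam (σ : ℕ ⊕ Fin 0 → Tm L 0) (a : ℕ) (t : Tm L 0) : ℕ ⊕ Fin 0 → Tm L 0 :=
  Function.update σ (.inl a) t

theorem Fml.subst_updateParam (A : Fml L 0) {σ : ℕ ⊕ Fin 0 → Tm L 0} {a : ℕ} {t : Tm L 0}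
    (ha : a ∉ A.params) : A.subst (updateParam σ a t) = A.subst σ := by
  refine A.subst_congr (fun b hb => ?_) (fun i => i.elim0)
  have : b ≠ a := fun h => ha (h ▸ hb)
  simp [updateParam, this]

/-- Turns the single eigenvariable premiss into the premiss for an arbitrary term: the substitution
is changed only at the eigenvariable, which `A` does not contain. -/
theorem Fml.inst_par_subst_updateParam (A : Fml L 1) {σ : ℕ ⊕ Fin 0 → Tm L 0} {a : ℕ}
    {t : Tm L 0} (ha : a ∉ A.params) :
    (A.inst (par a)).subst (updateParam σ a t) = (A.subst (liftSubst σ)).inst t := by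
  rw [Fml.inst_subst]
  have h1 : (par a : Tm L 0).subst (updateParam σ a t) = t := by
    simp [par, FirstOrder.Language.Term.subst, updateParam]
  have h2 : A.subst (liftSubst (updateParam σ a t)) = A.subst (liftSubst σ) := by
    obtain ⟨h, h'⟩ := liftSubst_congr (σ := updateParam σ a t) (τ := σ) A.params
      (fun b hb => by
        have : b ≠ a := fun h => ha (h ▸ hb)
        simp [updateParam, this]) (fun i => i.elim0)
    exact A.subst_congr h h'
  rw [h1, h2]

/-- The number of logical constants in a formula. -/
def Fml.size : {n : ℕ} → Fml L n → ℕ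
  | _, .rel _ _ => 0
  | _, .eq _ _ => 0
  | _, .bot => 0
  | _, .and A B => A.size + B.size + 1
  | _, .or A B => A.size + B.size + 1
  | _, .imp A B => A.size + B.size + 1
  | _, .all A => A.size + 1
  | _, .ex A => A.size + 1

theorem Fml.size_subst {n : ℕ} (A : Fml L n) {m : ℕ} (σ : ℕ ⊕ Fin n → Tm L m) :
    (A.subst σ).size = A.size := by
  induction A generalizing m with
  | rel | eq | bot => rfl
  | and A B ihA ihB | or A B ihA ihB | imp A B ihA ihB => simp only [Fml.subst, Fml.size, ihA, ihB]
  | all A ih | ex A ih => simp only [Fml.subst, Fml.size, ih]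

/-- Terms do not count towards the size, so every instance of a quantified cut formula is smaller
than it. -/
theorem Fml.size_inst (A : Fml L 1) (t : Tm L 0) : (A.inst t).size = A.size := A.size_subst _

/-! ### A cumulative calculus on sets of formulas -/

/-- The side formulas on the right that survive, read upwards, a right rule for `→` or `∀`. -/
def keep (l : Logic) (Δ : Set (Fml L 0)) : Set (Fml L 0) := {A | A ∈ Δ ∧ l = .c}

theorem keep_mono {l : Logic} {Δ Δ' : Set (Fml L 0)} (h : Δ ⊆ Δ') : keep l Δ ⊆ keep l Δ' :=
  fun _ hA => ⟨h hA.1, hA.2⟩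

theorem keep_subset (l : Logic) (Δ : Set (Fml L 0)) : keep l Δ ⊆ Δ := fun _ hA => hA.1

theorem keep_classical (Δ : Set (Fml L 0)) : keep .c Δ = Δ := by
  ext
  simp [keep]

theorem keep_of_ne {l : Logic} (hl : l ≠ .c) (Δ : Set (Fml L 0)) : keep l Δ = ∅ := by
  ext
  simp [keep, hl]

/-- The calculus with equality in which sequents are pairs of sets, every principal formula is
repeated in the premisses, and a rule with an eigenvariable has a premiss for every term. -/
inductive CDer (l : Logic) : Set (Fml L 0) → Set (Fml L 0) → Prop
  | init {Γ Δ} (P : Fml L 0) (hP : P.IsAtomic) (hΓ : P ∈ Γ) (hΔ : P ∈ Δ) : CDer l Γ Δ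
  | botInit {Γ Δ} (hΓ : .bot ∈ Γ) (hΔ : l = .m → .bot ∈ Δ) : CDer l Γ Δ
  | andL {Γ Δ} (A B : Fml L 0) (h : .and A B ∈ Γ)
      (d : CDer l (insert A (insert B Γ)) Δ) : CDer l Γ Δ
  | andR {Γ Δ} (A B : Fml L 0) (h : .and A B ∈ Δ)
      (d₁ : CDer l Γ (insert A Δ)) (d₂ : CDer l Γ (insert B Δ)) : CDer l Γ Δ
  | orL {Γ Δ} (A B : Fml L 0) (h : .or A B ∈ Γ)
      (d₁ : CDer l (insert A Γ) Δ) (d₂ : CDer l (insert B Γ) Δ) : CDer l Γ Δ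
  | orR {Γ Δ} (A B : Fml L 0) (h : .or A B ∈ Δ)
      (d : CDer l Γ (insert A (insert B Δ))) : CDer l Γ Δ
  | impL {Γ Δ} (A B : Fml L 0) (h : .imp A B ∈ Γ)
      (d₁ : CDer l Γ (insert A Δ)) (d₂ : CDer l (insert B Γ) Δ) : CDer l Γ Δ
  | impR {Γ Δ} (A B : Fml L 0) (h : .imp A B ∈ Δ)
      (d : CDer l (insert A Γ) (insert B (keep l Δ))) : CDer l Γ Δ
  | allL {Γ Δ} (A : Fml L 1) (t : Tm L 0) (h : .all A ∈ Γ)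
      (d : CDer l (insert (A.inst t) Γ) Δ) : CDer l Γ Δ
  | allR {Γ Δ} (A : Fml L 1) (h : .all A ∈ Δ)
      (d : ∀ t, CDer l Γ (insert (A.inst t) (keep l Δ))) : CDer l Γ Δ
  | exL {Γ Δ} (A : Fml L 1) (h : .ex A ∈ Γ)
      (d : ∀ t, CDer l (insert (A.inst t) Γ) Δ) : CDer l Γ Δ
  | exR {Γ Δ} (A : Fml L 1) (t : Tm L 0) (h : .ex A ∈ Δ)
      (d : CDer l Γ (insert (A.inst t) Δ)) : CDer l Γ Δ
  | ref {Γ Δ} (t : Tm L 0) (d : CDer l (insert (.eq t t) Γ) Δ) : CDer l Γ Δ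
  | repl {Γ Δ} (s r : Tm L 0) (P : Fml L 1) (hP : P.IsAtomic) (h₁ : .eq s r ∈ Γ)
      (h₂ : P.inst s ∈ Γ) (d : CDer l (insert (P.inst r) Γ) Δ) : CDer l Γ Δ

namespace CDer

variable {l : Logic}

theorem mono {Γ Δ : Set (Fml L 0)} (d : CDer l Γ Δ) {Γ' Δ' : Set (Fml L 0)} (hΓ : Γ ⊆ Γ')
    (hΔ : Δ ⊆ Δ') : CDer l Γ' Δ' := by
  have ins : ∀ {X Y : Set (Fml L 0)} (A : Fml L 0), X ⊆ Y → insert A X ⊆ insert A Y :=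
    fun _ h => Set.insert_subset_insert h
  induction d generalizing Γ' Δ' with
  | init P hP h₁ h₂ => exact .init P hP (hΓ h₁) (hΔ h₂)
  | botInit h₁ h₂ => exact .botInit (hΓ h₁) (fun h => hΔ (h₂ h))
  | andL A B h _ ih => exact .andL A B (hΓ h) (ih (ins _ (ins _ hΓ)) hΔ)
  | andR A B h _ _ ih₁ ih₂ => exact .andR A B (hΔ h) (ih₁ hΓ (ins _ hΔ)) (ih₂ hΓ (ins _ hΔ))
  | orL A B h _ _ ih₁ ih₂ => exact .orL A B (hΓ h) (ih₁ (ins _ hΓ) hΔ) (ih₂ (ins _ hΓ) hΔ)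
  | orR A B h _ ih => exact .orR A B (hΔ h) (ih hΓ (ins _ (ins _ hΔ)))
  | impL A B h _ _ ih₁ ih₂ => exact .impL A B (hΓ h) (ih₁ hΓ (ins _ hΔ)) (ih₂ (ins _ hΓ) hΔ)
  | impR A B h _ ih => exact .impR A B (hΔ h) (ih (ins _ hΓ) (ins _ (keep_mono hΔ)))
  | allL A t h _ ih => exact .allL A t (hΓ h) (ih (ins _ hΓ) hΔ)
  | allR A h _ ih => exact .allR A (hΔ h) (fun t => ih t hΓ (ins _ (keep_mono hΔ)))
  | exL A h _ ih => exact .exL A (hΓ h) (fun t => ih t (ins _ hΓ) hΔ)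
  | exR A t h _ ih => exact .exR A t (hΔ h) (ih hΓ (ins _ hΔ))
  | ref t _ ih => exact .ref t (ih (ins _ hΓ) hΔ)
  | repl s r P hP h₁ h₂ _ ih => exact .repl s r P hP (hΓ h₁) (hΓ h₂) (ih (ins _ hΓ) hΔ)

/-! ### Removing compound formulas from the antecedent; inversion -/

/-- The premisses of some instance of the left rule with the compound principal formula `F`, the
principal formula itself being left out. -/
def LeftPrem (l : Logic) (Γ Δ : Set (Fml L 0)) : Fml L 0 → Prop
  | .and A B => CDer l (insert A (insert B Γ)) Δ
  | .or A B => CDer l (insert A Γ) Δ ∧ CDer l (insert B Γ) Δ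
  | .imp A B => CDer l Γ (insert A Δ) ∧ CDer l (insert B Γ) Δ
  | .all A => ∃ t, CDer l (insert (A.inst t) Γ) Δ
  | .ex A => ∀ t, CDer l (insert (A.inst t) Γ) Δ
  | _ => False

/-- A compound formula `F` may be removed from the antecedent in any class `R` of sequents that is
closed under the passage to premisses and admits the left rule for `F` without its principal
formula. -/
theorem left_replace {F : Fml L 0} (hF : ¬ F.IsAtomic) (hF' : F ≠ .bot)
    {R : Set (Fml L 0) → Set (Fml L 0) → Prop}
    (mono : ∀ {Γ Δ Γ' Δ'}, R Γ Δ → Γ ⊆ Γ' → keep l Δ ⊆ Δ' → R Γ' Δ')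
    (step : ∀ {Γ Δ}, R Γ Δ → LeftPrem l Γ Δ F → CDer l Γ Δ)
    {Γ Δ : Set (Fml L 0)} (d : CDer l Γ Δ) {Γ' Δ' : Set (Fml L 0)} (hΓ : Γ ⊆ insert F Γ')
    (hΔ : Δ ⊆ Δ') (hR : R Γ' Δ') : CDer l Γ' Δ' := by
  have ins : ∀ {X Y : Set (Fml L 0)} (A : Fml L 0), X ⊆ Y → insert A X ⊆ insert A Y :=
    fun _ h => Set.insert_subset_insert h
  have ins' : ∀ {X Y : Set (Fml L 0)} (A : Fml L 0), X ⊆ insert F Y →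
      insert A X ⊆ insert F (insert A Y) :=
    fun A h => Set.insert_comm A F _ ▸ Set.insert_subset_insert h
  have rl : ∀ {X Y : Set (Fml L 0)} (A : Fml L 0), R X Y → R (insert A X) Y :=
    fun A h => mono h (Set.subset_insert _ _) (keep_subset _ _)
  have rr : ∀ {X Y : Set (Fml L 0)} (A : Fml L 0), R X Y → R X (insert A Y) :=
    fun A h => mono h subset_rfl ((keep_subset _ _).trans (Set.subset_insert _ _))
  -- The right rules for `→` and `∀` may discard the succedent; this is why `mono` asks only for
  -- `keep l Δ ⊆ Δ'`.
  have rk : ∀ {X Y : Set (Fml L 0)} (A : Fml L 0), R X Y → R X (insert A (keep l Y)) :=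
    fun A h => mono h subset_rfl (Set.subset_insert _ _)
  induction d generalizing Γ' Δ' with
  | init P hP h₁ h₂ =>
    rcases hΓ h₁ with rfl | h
    · exact absurd hP hF
    · exact .init P hP h (hΔ h₂)
  | botInit h₁ h₂ =>
    rcases hΓ h₁ with h | h
    · exact absurd h.symm hF'
    · exact .botInit h (fun h => hΔ (h₂ h))
  | andL A B h _ ih =>
    have e := ih (ins' _ (ins' _ hΓ)) hΔ (rl _ (rl _ hR))
    rcases hΓ h with rfl | h
    · exact step hR e
    · exact .andL A B h e
  | andR A B h _ _ ih₁ ih₂ =>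
    exact .andR A B (hΔ h) (ih₁ hΓ (ins _ hΔ) (rr _ hR)) (ih₂ hΓ (ins _ hΔ) (rr _ hR))
  | orL A B h _ _ ih₁ ih₂ =>
    have e₁ := ih₁ (ins' _ hΓ) hΔ (rl _ hR)
    have e₂ := ih₂ (ins' _ hΓ) hΔ (rl _ hR)
    rcases hΓ h with rfl | h
    · exact step hR ⟨e₁, e₂⟩
    · exact .orL A B h e₁ e₂
  | orR A B h _ ih => exact .orR A B (hΔ h) (ih hΓ (ins _ (ins _ hΔ)) (rr _ (rr _ hR)))
  | impL A B h _ _ ih₁ ih₂ =>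
    have e₁ := ih₁ hΓ (ins _ hΔ) (rr _ hR)
    have e₂ := ih₂ (ins' _ hΓ) hΔ (rl _ hR)
    rcases hΓ h with rfl | h
    · exact step hR ⟨e₁, e₂⟩
    · exact .impL A B h e₁ e₂
  | impR A B h _ ih =>
    exact .impR A B (hΔ h) (ih (ins' _ hΓ) (ins _ (keep_mono hΔ)) (rl _ (rk _ hR)))
  | allL A t h _ ih =>
    have e := ih (ins' _ hΓ) hΔ (rl _ hR)
    rcases hΓ h with rfl | h
    · exact step hR ⟨t, e⟩
    · exact .allL A t h e
  | allR A h _ ih =>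
    exact .allR A (hΔ h) (fun t => ih t hΓ (ins _ (keep_mono hΔ)) (rk _ hR))
  | exL A h _ ih =>
    have e := fun t => ih t (ins' _ hΓ) hΔ (rl _ hR)
    rcases hΓ h with rfl | h
    · exact step hR e
    · exact .exL A h e
  | exR A t h _ ih => exact .exR A t (hΔ h) (ih hΓ (ins _ hΔ) (rr _ hR))
  | ref t _ ih => exact .ref t (ih (ins' _ hΓ) hΔ (rl _ hR))
  | repl s r P hP h₁ h₂ _ ih =>
    have e := ih (ins' _ hΓ) hΔ (rl _ hR)
    rcases hΓ h₁ with rfl | h₁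
    · exact absurd (.eq _ _) hF
    rcases hΓ h₂ with rfl | h₂
    · exact absurd (hP.subst _) hF
    exact .repl s r P hP h₁ h₂ e

/-- Take for `R` the sequents whose antecedent already contains `A` and `B`: there the premiss of
the left rule is the conclusion itself. The other inversions follow the same pattern. -/
theorem and_left_inv {A B : Fml L 0} {Γ Δ : Set (Fml L 0)}
    (d : CDer l (insert (.and A B) Γ) Δ) : CDer l (insert A (insert B Γ)) Δ := by
  refine left_replace (F := .and A B) (R := fun Γ _ => A ∈ Γ ∧ B ∈ Γ) nofun nofun
    (fun h hΓ _ => ⟨hΓ h.1, hΓ h.2⟩) (fun h e => ?_) d ?_ subset_rfl ?_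
  · simpa [LeftPrem, h.1, h.2] using e
  · exact Set.insert_subset_insert
      ((Set.subset_insert _ _).trans (Set.subset_insert _ _))
  · simp

theorem or_left_inv {A B : Fml L 0} {Γ Δ : Set (Fml L 0)}
    (d : CDer l (insert (.or A B) Γ) Δ) : CDer l (insert A Γ) Δ ∧ CDer l (insert B Γ) Δ := by
  constructor
  · refine left_replace (F := .or A B) (R := fun Γ _ => A ∈ Γ) nofun nofun
      (fun h hΓ _ => hΓ h) (fun h e => ?_) d (Set.insert_subset_insert (Set.subset_insert _ _))
      subset_rfl (by simp)
    simpa [h] using e.1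
  · refine left_replace (F := .or A B) (R := fun Γ _ => B ∈ Γ) nofun nofun
      (fun h hΓ _ => hΓ h) (fun h e => ?_) d (Set.insert_subset_insert (Set.subset_insert _ _))
      subset_rfl (by simp)
    simpa [h] using e.2

theorem ex_left_inv {A : Fml L 1} {Γ Δ : Set (Fml L 0)}
    (d : CDer l (insert (.ex A) Γ) Δ) (t : Tm L 0) : CDer l (insert (A.inst t) Γ) Δ := by
  refine left_replace (F := .ex A) (R := fun Γ _ => A.inst t ∈ Γ) nofun nofun
    (fun h hΓ _ => hΓ h) (fun h e => ?_) d (Set.insert_subset_insert (Set.subset_insert _ _))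
    subset_rfl (by simp)
  simpa [h] using e t

/-! ### Cut in the cumulative calculus -/

/-- Cut on the formula `F` with shared contexts. -/
def CutFor (l : Logic) (F : Fml L 0) : Prop :=
  ∀ {Γ Δ : Set (Fml L 0)}, CDer l Γ (insert F Δ) → CDer l (insert F Γ) Δ → CDer l Γ Δ

/-- Outside classical logic the left rule for `→` is not invertible in its first premiss, so the
induction runs over `d₂`. The class `R` consists of the sequents to which the context of `d₁` can be
weakened; that context uses only `keep l Δ`, and so survives the rules that discard the succedent.
-/
theorem cut_imp_principal {A B : Fml L 0} (hA : CutFor l A) (hB : CutFor l B)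
    {Γ Δ : Set (Fml L 0)} (d₁ : CDer l (insert A Γ) (insert B (keep l Δ)))
    (d₂ : CDer l (insert (.imp A B) Γ) Δ) : CDer l Γ Δ := by
  refine left_replace (F := .imp A B) (R := fun Γ' Δ' => Γ ⊆ Γ' ∧ keep l Δ ⊆ keep l Δ')
    nofun nofun ?_ ?_ d₂ subset_rfl subset_rfl ⟨subset_rfl, subset_rfl⟩
  · rintro Γ₁ Δ₁ Γ' Δ' ⟨h₁, h₂⟩ hΓ hΔ
    exact ⟨h₁.trans hΓ, fun C hC => ⟨hΔ (h₂ hC), hC.2⟩⟩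
  · rintro Γ' Δ' ⟨h₁, h₂⟩ ⟨e₁, e₂⟩
    -- The inner cut on `B` joins `d₁` with `e₂` and leaves `A` on the left; the outer cut on `A` is
    -- against `e₁`.
    refine hA e₁ (hB (d₁.mono (Set.insert_subset_insert h₁)
      (Set.insert_subset_insert (h₂.trans (keep_subset _ _)))) ?_)
    exact e₂.mono (Set.insert_subset_insert (Set.subset_insert _ _)) subset_rfl

theorem cut_all_principal {A : Fml L 1} (hA : ∀ t, CutFor l (A.inst t))
    {Γ Δ : Set (Fml L 0)} (d₁ : ∀ t, CDer l Γ (insert (A.inst t) (keep l Δ)))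
    (d₂ : CDer l (insert (.all A) Γ) Δ) : CDer l Γ Δ := by
  refine left_replace (F := .all A) (R := fun Γ' Δ' => Γ ⊆ Γ' ∧ keep l Δ ⊆ keep l Δ')
    nofun nofun ?_ ?_ d₂ subset_rfl subset_rfl ⟨subset_rfl, subset_rfl⟩
  · rintro Γ₁ Δ₁ Γ' Δ' ⟨h₁, h₂⟩ hΓ hΔ
    exact ⟨h₁.trans hΓ, fun C hC => ⟨hΔ (h₂ hC), hC.2⟩⟩
  · rintro Γ' Δ' ⟨h₁, h₂⟩ ⟨t, e⟩
    exact hA t ((d₁ t).mono h₁ (Set.insert_subset_insert (h₂.trans (keep_subset _ _)))) e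

/-- Induction on the left premiss `d`, with the right premiss `e` weakened along. Where `F` is
principal, the induction has already removed its other copies from the premisses, so only cuts on
smaller formulas remain. -/
theorem cut_of_smaller {F : Fml L 0} (hF : ∀ A : Fml L 0, A.size < F.size → CutFor l A)
    {Γ Δ : Set (Fml L 0)} (d : CDer l Γ Δ) {Γ' Δ' : Set (Fml L 0)} (hΓ : Γ ⊆ Γ')
    (hΔ : Δ ⊆ insert F Δ') (e : CDer l (insert F Γ') Δ') : CDer l Γ' Δ' := by
  have ins : ∀ {X Y : Set (Fml L 0)} (A : Fml L 0), X ⊆ Y → insert A X ⊆ insert A Y :=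
    fun _ h => Set.insert_subset_insert h
  have ins' : ∀ {X Y : Set (Fml L 0)} (A : Fml L 0), X ⊆ insert F Y →
      insert A X ⊆ insert F (insert A Y) :=
    fun A h => Set.insert_comm A F _ ▸ Set.insert_subset_insert h
  have el : ∀ {X Y : Set (Fml L 0)} (A : Fml L 0), CDer l (insert F X) Y →
      CDer l (insert F (insert A X)) Y :=
    fun A h => h.mono (Set.insert_subset_insert (Set.subset_insert _ _)) subset_rfl
  have er : ∀ {X Y : Set (Fml L 0)} (A : Fml L 0), CDer l (insert F X) Y →
      CDer l (insert F X) (insert A Y) :=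
    fun A h => h.mono subset_rfl (Set.subset_insert _ _)
  induction d generalizing Γ' Δ' with
  | init P hP h₁ h₂ =>
    rcases hΔ h₂ with rfl | h
    -- The cut formula already lies in `Γ'`, so inserting it changes nothing and `e` is the goal.
    · simpa [hΓ h₁] using e
    · exact .init P hP (hΓ h₁) h
  | botInit h₁ h₂ =>
    by_cases hF : F = .bot
    · subst hF
      simpa [hΓ h₁] using e
    · exact .botInit (hΓ h₁) (fun h => (hΔ (h₂ h)).resolve_left (Ne.symm hF))
  | andL A B h _ ih => exact .andL A B (hΓ h) (ih (ins _ (ins _ hΓ)) hΔ (el _ (el _ e)))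
  | andR A B h _ _ ih₁ ih₂ =>
    have e₁ := ih₁ hΓ (ins' _ hΔ) (er _ e)
    have e₂ := ih₂ hΓ (ins' _ hΔ) (er _ e)
    rcases hΔ h with rfl | h
    · refine hF B (by simp only [Fml.size]; omega) e₂ (hF A (by simp only [Fml.size]; omega)
        (e₁.mono (Set.subset_insert _ _) subset_rfl) (and_left_inv e))
    · exact .andR A B h e₁ e₂
  | orL A B h _ _ ih₁ ih₂ =>
    exact .orL A B (hΓ h) (ih₁ (ins _ hΓ) hΔ (el _ e)) (ih₂ (ins _ hΓ) hΔ (el _ e))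
  | orR A B h _ ih =>
    have e₁ := ih hΓ (ins' _ (ins' _ hΔ)) (er _ (er _ e))
    rcases hΔ h with rfl | h
    · obtain ⟨eA, eB⟩ := or_left_inv e
      exact hF B (by simp only [Fml.size]; omega) (hF A (by simp only [Fml.size]; omega) e₁
        (eA.mono subset_rfl (Set.subset_insert _ _))) eB
    · exact .orR A B h e₁
  | impL A B h _ _ ih₁ ih₂ =>
    exact .impL A B (hΓ h) (ih₁ hΓ (ins' _ hΔ) (er _ e)) (ih₂ (ins _ hΓ) hΔ (el _ e))
  | @impR Γ Δ A B h d ih =>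
    have e₁ : CDer l (insert A Γ') (insert B (keep l Δ')) := by
      by_cases hl : l = .c
      · subst hl
        simp only [keep_classical] at ih ⊢
        exact ih (ins _ hΓ) (ins' _ hΔ) (el _ (er _ e))
      -- Here the premiss has lost the whole side succedent, the cut formula included, so weakening
      -- suffices.
      · rw [keep_of_ne hl] at d ⊢
        exact d.mono (ins _ hΓ) subset_rfl
    rcases hΔ h with rfl | h
    · exact cut_imp_principal (hF A (by simp only [Fml.size]; omega))
        (hF B (by simp only [Fml.size]; omega)) e₁ e
    · exact .impR A B h e₁
  | allL A t h _ ih => exact .allL A t (hΓ h) (ih (ins _ hΓ) hΔ (el _ e))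
  | @allR Γ Δ A h d ih =>
    have e₁ : ∀ t, CDer l Γ' (insert (A.inst t) (keep l Δ')) := by
      intro t
      by_cases hl : l = .c
      · subst hl
        simp only [keep_classical] at ih ⊢
        exact ih t hΓ (ins' _ hΔ) (er _ e)
      · have d := d t
        rw [keep_of_ne hl] at d ⊢
        exact d.mono hΓ subset_rfl
    rcases hΔ h with rfl | h
    · exact cut_all_principal
        (fun t => hF (A.inst t) (by simp only [Fml.size, Fml.size_inst]; omega)) e₁ e
    · exact .allR A h e₁
  | exL A h _ ih => exact .exL A (hΓ h) (fun t => ih t (ins _ hΓ) hΔ (el _ e))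
  | exR A t h _ ih =>
    have e₁ := ih hΓ (ins' _ hΔ) (er _ e)
    rcases hΔ h with rfl | h
    · exact hF (A.inst t) (by simp only [Fml.size, Fml.size_inst]; omega) e₁ (ex_left_inv e t)
    · exact .exR A t h e₁
  | ref t _ ih => exact .ref t (ih (ins _ hΓ) hΔ (el _ e))
  | repl s r P hP h₁ h₂ _ ih =>
    exact .repl s r P hP (hΓ h₁) (hΓ h₂) (ih (ins _ hΓ) hΔ (el _ e))

theorem cut (F : Fml L 0) : CutFor l F := by
  induction hn : F.size using Nat.strong_induction_on generalizing F with
  | _ n ih =>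
    subst hn
    exact fun d e => cut_of_smaller (fun A hA => ih A.size hA A rfl) d subset_rfl subset_rfl e

end CDer

/-! ### From the calculus of the theorem to the cumulative calculus -/

/-- The set of instances of the formulas of a multiset under a substitution for the parameters. -/
def image (σ : ℕ ⊕ Fin 0 → Tm L 0) (Γ : Multiset (Fml L 0)) : Set (Fml L 0) :=
  {B | ∃ A ∈ Γ, A.subst σ = B}

theorem image_cons (σ : ℕ ⊕ Fin 0 → Tm L 0) (A : Fml L 0) (Γ : Multiset (Fml L 0)) :
    image σ (A ::ₘ Γ) = insert (A.subst σ) (image σ Γ) := by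
  ext B
  simp [image, eq_comm]

theorem image_singleton (σ : ℕ ⊕ Fin 0 → Tm L 0) (A : Fml L 0) :
    image σ {A} = {A.subst σ} := by
  ext B
  simp [image, eq_comm]

theorem image_updateParam {σ : ℕ ⊕ Fin 0 → Tm L 0} {a : ℕ} {t : Tm L 0}
    {Γ : Multiset (Fml L 0)} (h : ∀ B ∈ Γ, a ∉ B.params) :
    image (updateParam σ a t) Γ = image σ Γ := by
  ext B
  constructor <;> rintro ⟨A, hA, rfl⟩ <;> refine ⟨A, hA, ?_⟩ <;>
    simp only [A.subst_updateParam (h A hA)]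

theorem image_var (Γ : Multiset (Fml L 0)) :
    image FirstOrder.Language.Term.var Γ = {A | A ∈ Γ} := by
  ext B
  simp [image, Fml.subst_var]

/-- Quantifying over all `σ` makes the induction hypothesis at an eigenvariable premiss yield every
term instance: change `σ` at the eigenvariable, and freshness leaves the context unchanged. No
renaming of parameters is needed. -/
theorem CDer.of_derivable_subst {l : Logic} {S : Sequent L} (d : Derivable (G3Eq L l) S)
    (σ : ℕ ⊕ Fin 0 → Tm L 0) : CDer l (image σ S.ant) (image σ S.suc) := by
  have sub : ∀ (A : Fml L 0) (X : Set (Fml L 0)), X ⊆ insert A X :=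
    fun A X => Set.subset_insert A X
  have ins : ∀ (A : Fml L 0) {X Y : Set (Fml L 0)}, X ⊆ Y → insert A X ⊆ insert A Y :=
    fun A _ _ h => Set.insert_subset_insert h
  induction d generalizing σ with
  | infer h hd ih =>
    clear hd
    rcases h with h | h
    · cases h <;>
        simp only [List.mem_cons, List.not_mem_nil, or_false, forall_eq_or_imp, forall_eq,
          image_cons, image_singleton, false_imp_iff] at ih ⊢
      case init P hP Γ Δ => exact .init _ (hP.subst σ) (.inl rfl) (.inl rfl)
      case botInit => exact .botInit (.inl rfl) (fun _ => .inl rfl)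
      case botL _ _ hl => exact .botInit (.inl rfl) (fun h => absurd h hl)
      case andL A B Γ Δ =>
        exact .andL _ _ (.inl rfl) ((ih σ).mono (ins _ (ins _ (sub _ _))) subset_rfl)
      case andR A B Γ Δ =>
        exact .andR _ _ (.inl rfl) ((ih.1 σ).mono subset_rfl (ins _ (sub _ _)))
          ((ih.2 σ).mono subset_rfl (ins _ (sub _ _)))
      case orL A B Γ Δ =>
        exact .orL _ _ (.inl rfl) ((ih.1 σ).mono (ins _ (sub _ _)) subset_rfl)
          ((ih.2 σ).mono (ins _ (sub _ _)) subset_rfl)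
      case orR A B Γ Δ =>
        exact .orR _ _ (.inl rfl) ((ih σ).mono subset_rfl (ins _ (ins _ (sub _ _))))
      case impL A B Γ Δ =>
        exact .impL _ _ (.inl rfl) ((ih.1 σ).mono (sub _ _) subset_rfl)
          ((ih.2 σ).mono (ins _ (sub _ _)) subset_rfl)
      case impR A B Γ Δ =>
        refine .impR _ _ (.inl rfl) ((ih σ).mono subset_rfl (ins _ ?_))
        rw [keep_classical]
        exact sub _ _
      case impLi A B Γ Δ =>
        exact .impL _ _ (.inl rfl) (ih.1 σ) ((ih.2 σ).mono (ins _ (sub _ _)) subset_rfl)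
      case impRi A B Γ Δ =>
        exact .impR _ _ (.inl rfl) ((ih σ).mono subset_rfl (by simp))
      case allL A t Γ Δ =>
        refine .allL _ (t.subst σ) (.inl rfl) ?_
        rw [← Fml.inst_subst]
        exact ih σ
      case allR A a Γ Δ ha =>
        refine .allR _ (.inl rfl) fun t => ?_
        have e := ih (updateParam σ a t)
        have hA : a ∉ A.params := ha.2 (.all A) (Multiset.mem_cons_self _ _)
        rw [image_updateParam ha.1, Fml.inst_par_subst_updateParam _ hA,
          image_updateParam fun B hB => ha.2 B (Multiset.mem_cons_of_mem hB)] at e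
        rw [keep_classical]
        exact e.mono subset_rfl (ins _ (sub _ _))
      case allRi A a Γ Δ ha hl =>
        refine .allR _ (.inl rfl) fun t => ?_
        have e := ih (updateParam σ a t)
        have hA : a ∉ A.params := ha.2 (.all A) (Multiset.mem_cons_self _ _)
        rw [image_updateParam ha.1, Fml.inst_par_subst_updateParam _ hA] at e
        exact e.mono subset_rfl (by simp)
      case exL A a Γ Δ ha =>
        refine .exL _ (.inl rfl) fun t => ?_
        have e := ih (updateParam σ a t)
        have hA : a ∉ A.params := ha.1 (.ex A) (Multiset.mem_cons_self _ _)
        rw [image_updateParam ha.2, Fml.inst_par_subst_updateParam _ hA,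
          image_updateParam fun B hB => ha.1 B (Multiset.mem_cons_of_mem hB)] at e
        exact e.mono (ins _ (sub _ _)) subset_rfl
      case exR A t Γ Δ =>
        refine .exR _ (t.subst σ) (.inl rfl) ?_
        rw [← Fml.inst_subst]
        exact ih σ
    · cases h <;>
        simp only [List.mem_cons, List.not_mem_nil, or_false, forall_eq,
          image_cons] at ih ⊢
      case ref t Γ Δ => exact .ref (t.subst σ) (ih σ)
      case repl s r P hP Γ Δ =>
        have e := ih σ
        simp only [Fml.inst_subst] at e ⊢
        refine .repl (s.subst σ) (r.subst σ) (P.subst (liftSubst σ)) (hP.subst _) (.inl rfl)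
          (.inr (.inl rfl)) (e.mono ?_ subset_rfl)
        intro B hB
        simp only [Set.mem_insert_iff, Fml.subst] at hB ⊢
        tauto

theorem CDer.of_derivable {l : Logic} {Γ Δ : Multiset (Fml L 0)}
    (d : Derivable (G3Eq L l) (Γ ⇒ Δ)) : CDer l {A | A ∈ Γ} {A | A ∈ Δ} := by
  simpa only [image_var] using of_derivable_subst d FirstOrder.Language.Term.var

/-! ### From the cumulative calculus back to the calculus of the theorem -/

/-- The formula `A` is covered, on the left (`true`) or on the right (`false`), by the sequent
`Γ ⇒ Δ`: it occurs there, or the immediate subformulas that replace it in some premiss of an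
invertible rule are covered. -/
inductive Cov (l : Logic) (Γ Δ : Multiset (Fml L 0)) : Bool → Fml L 0 → Prop
  | memL {A} (h : A ∈ Γ) : Cov l Γ Δ true A
  | memR {A} (h : A ∈ Δ) : Cov l Γ Δ false A
  | andL {A B} (h₁ : Cov l Γ Δ true A) (h₂ : Cov l Γ Δ true B) : Cov l Γ Δ true (.and A B)
  | andR₁ {A B} (h : Cov l Γ Δ false A) : Cov l Γ Δ false (.and A B)
  | andR₂ {A B} (h : Cov l Γ Δ false B) : Cov l Γ Δ false (.and A B)
  | orL₁ {A B} (h : Cov l Γ Δ true A) : Cov l Γ Δ true (.or A B)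
  | orL₂ {A B} (h : Cov l Γ Δ true B) : Cov l Γ Δ true (.or A B)
  | orR {A B} (h₁ : Cov l Γ Δ false A) (h₂ : Cov l Γ Δ false B) : Cov l Γ Δ false (.or A B)
  | impL₁ {A B} (hl : l = .c) (h : Cov l Γ Δ false A) : Cov l Γ Δ true (.imp A B)
  | impL₂ {A B} (h : Cov l Γ Δ true B) : Cov l Γ Δ true (.imp A B)
  | impR {A B} (hl : l = .c) (h₁ : Cov l Γ Δ true A) (h₂ : Cov l Γ Δ false B) :
      Cov l Γ Δ false (.imp A B)
  | allR {A} (hl : l = .c) (t : Tm L 0) (h : Cov l Γ Δ false (A.inst t)) :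
      Cov l Γ Δ false (.all A)
  | exL {A} (t : Tm L 0) (h : Cov l Γ Δ true (A.inst t)) : Cov l Γ Δ true (.ex A)

namespace Cov

variable {l : Logic} {Γ Δ Γ' Δ' : Multiset (Fml L 0)}

theorem trans {b : Bool} {F : Fml L 0} (h : Cov l Γ Δ b F) (hΓ : ∀ A ∈ Γ, Cov l Γ' Δ' true A)
    (hΔ : ∀ A ∈ Δ, Cov l Γ' Δ' false A) : Cov l Γ' Δ' b F := by
  induction h with
  | memL h => exact hΓ _ h
  | memR h => exact hΔ _ h
  | andL _ _ ih₁ ih₂ => exact .andL ih₁ ih₂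
  | andR₁ _ ih => exact .andR₁ ih
  | andR₂ _ ih => exact .andR₂ ih
  | orL₁ _ ih => exact .orL₁ ih
  | orL₂ _ ih => exact .orL₂ ih
  | orR _ _ ih₁ ih₂ => exact .orR ih₁ ih₂
  | impL₁ hl _ ih => exact .impL₁ hl ih
  | impL₂ _ ih => exact .impL₂ ih
  | impR hl _ _ ih₁ ih₂ => exact .impR hl ih₁ ih₂
  | allR hl t _ ih => exact .allR hl t ih
  | exL t _ ih => exact .exL t ih

/-- Only `impL₁` lets a formula on the left be covered through the succedent, and it is classical.
Hence left coverage survives the rules that discard the succedent. -/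
theorem change_suc (hl : l ≠ .c) {F : Fml L 0} (h : Cov l Γ Δ true F) : Cov l Γ Δ' true F := by
  generalize hb : true = b at h
  induction h with
  | memL h => exact .memL h
  | memR | andR₁ | andR₂ | orR | impR | allR => cases hb
  | andL _ _ ih₁ ih₂ => exact .andL (ih₁ hb) (ih₂ hb)
  | orL₁ _ ih => exact .orL₁ (ih hb)
  | orL₂ _ ih => exact .orL₂ (ih hb)
  | impL₁ h => exact absurd h hl
  | impL₂ _ ih => exact .impL₂ (ih hb)
  | exL t _ ih => exact .exL t (ih hb)

/-- Atoms and `⊥` have no components to cover them, so axioms and `Repl` find their principal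
formulas actually present. -/
theorem mem_ant {F : Fml L 0} (h : Cov l Γ Δ true F) (hF : F.IsAtomic ∨ F = .bot) : F ∈ Γ := by
  cases h with
  | memL h => exact h
  | _ => rcases hF with h | h <;> cases h

theorem mem_suc {F : Fml L 0} (h : Cov l Γ Δ false F) (hF : F.IsAtomic ∨ F = .bot) : F ∈ Δ := by
  cases h with
  | memR h => exact h
  | _ => rcases hF with h | h <;> cases h

theorem consL (A : Fml L 0) {b : Bool} {F : Fml L 0} (h : Cov l Γ Δ b F) :
    Cov l (A ::ₘ Γ) Δ b F :=
  h.trans (fun _ h => .memL (Multiset.mem_cons_of_mem h)) (fun _ h => .memR h)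

theorem consR (A : Fml L 0) {b : Bool} {F : Fml L 0} (h : Cov l Γ Δ b F) :
    Cov l Γ (A ::ₘ Δ) b F :=
  h.trans (fun _ h => .memL h) (fun _ h => .memR (Multiset.mem_cons_of_mem h))

theorem headL (A : Fml L 0) : Cov l (A ::ₘ Γ) Δ true A := .memL (Multiset.mem_cons_self _ _)

theorem headR (A : Fml L 0) : Cov l Γ (A ::ₘ Δ) false A := .memR (Multiset.mem_cons_self _ _)

end Cov

/-- Every formula of the set sequent `Γ, Δ` is covered by the sequent `Γ' ⇒ Δ'`. -/
def Covers (l : Logic) (Γ' Δ' : Multiset (Fml L 0)) (Γ Δ : Set (Fml L 0)) : Prop :=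
  (∀ A ∈ Γ, Cov l Γ' Δ' true A) ∧ ∀ A ∈ Δ, Cov l Γ' Δ' false A

namespace Covers

variable {l : Logic} {Γ₁ Δ₁ Γ₂ Δ₂ : Multiset (Fml L 0)} {Γ Δ : Set (Fml L 0)}

theorem trans (h : Covers l Γ₁ Δ₁ Γ Δ) (h' : Covers l Γ₂ Δ₂ {A | A ∈ Γ₁} {A | A ∈ Δ₁}) :
    Covers l Γ₂ Δ₂ Γ Δ :=
  ⟨fun A hA => (h.1 A hA).trans h'.1 h'.2, fun A hA => (h.2 A hA).trans h'.1 h'.2⟩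

theorem insL {A : Fml L 0} (hA : Cov l Γ₁ Δ₁ true A) (h : Covers l Γ₁ Δ₁ Γ Δ) :
    Covers l Γ₁ Δ₁ (insert A Γ) Δ :=
  ⟨by rintro B (rfl | hB); exacts [hA, h.1 B hB], h.2⟩

theorem insR {A : Fml L 0} (hA : Cov l Γ₁ Δ₁ false A) (h : Covers l Γ₁ Δ₁ Γ Δ) :
    Covers l Γ₁ Δ₁ Γ (insert A Δ) :=
  ⟨h.1, by rintro B (rfl | hB); exacts [hA, h.2 B hB]⟩

theorem refl : Covers l Γ₁ Δ₁ {A | A ∈ Γ₁} {A | A ∈ Δ₁} :=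
  ⟨fun _ h => .memL h, fun _ h => .memR h⟩

theorem consL (A : Fml L 0) (h : Covers l Γ₁ Δ₁ Γ Δ) : Covers l (A ::ₘ Γ₁) Δ₁ Γ Δ :=
  ⟨fun B hB => (h.1 B hB).consL A, fun B hB => (h.2 B hB).consL A⟩

theorem consR (A : Fml L 0) (h : Covers l Γ₁ Δ₁ Γ Δ) : Covers l Γ₁ (A ::ₘ Δ₁) Γ Δ :=
  ⟨fun B hB => (h.1 B hB).consR A, fun B hB => (h.2 B hB).consR A⟩

/-- In a covering sequent a formula on the left may be replaced by formulas that cover it. -/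
theorem replaceL {F : Fml L 0} (h : Covers l (F ::ₘ Γ₁) Δ₁ Γ Δ) (hΓ : Γ₁ ≤ Γ₂) (hΔ : Δ₁ ≤ Δ₂)
    (hF : Cov l Γ₂ Δ₂ true F) : Covers l Γ₂ Δ₂ Γ Δ := by
  refine h.trans ⟨fun A hA => ?_, fun A hA => .memR (Multiset.mem_of_le hΔ hA)⟩
  rcases Multiset.mem_cons.1 hA with rfl | hA
  · exact hF
  · exact .memL (Multiset.mem_of_le hΓ hA)

/-- In a covering sequent a formula on the right may be replaced by formulas that cover it. -/
theorem replaceR {F : Fml L 0} (h : Covers l Γ₁ (F ::ₘ Δ₁) Γ Δ) (hΓ : Γ₁ ≤ Γ₂) (hΔ : Δ₁ ≤ Δ₂)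
    (hF : Cov l Γ₂ Δ₂ false F) : Covers l Γ₂ Δ₂ Γ Δ := by
  refine h.trans ⟨fun A hA => .memL (Multiset.mem_of_le hΓ hA), fun A hA => ?_⟩
  rcases Multiset.mem_cons.1 hA with rfl | hA
  · exact hF
  · exact .memR (Multiset.mem_of_le hΔ hA)

theorem keep_of_ne (hl : l ≠ .c) (h : Covers l Γ₁ Δ₁ Γ Δ) : Covers l Γ₁ Δ₂ Γ (keep l Δ) :=
  ⟨fun A hA => (h.1 A hA).change_suc hl, fun _ hA => absurd hA.2 hl⟩

end Covers

theorem exists_fresh (S : Sequent L) : ∃ a, S.Fresh a := by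
  classical
  obtain ⟨a, ha⟩ := Infinite.exists_notMem_finset
    ((S.ant.toFinset ∪ S.suc.toFinset).biUnion Fml.params)
  simp only [Finset.mem_biUnion, Finset.mem_union, Multiset.mem_toFinset, not_exists,
    not_and] at ha
  exact ⟨a, fun B hB => ha B (.inl hB), fun B hB => ha B (.inr hB)⟩

/-! ### Simulating `Repl` on multisets -/

namespace Derivable

variable {l : Logic} {Γ Δ : Multiset (Fml L 0)}

theorem rule₀ {S : Sequent L} (h : G3mic L l [] S) : Derivable (G3Eq L l) S :=
  .infer (.inl h) (by simp)

theorem rule₁ {S T : Sequent L} (h : G3mic L l [T] S) (d : Derivable (G3Eq L l) T) :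
    Derivable (G3Eq L l) S :=
  .infer (.inl h) (by simpa using d)

theorem rule₂ {S T U : Sequent L} (h : G3mic L l [T, U] S) (d₁ : Derivable (G3Eq L l) T)
    (d₂ : Derivable (G3Eq L l) U) : Derivable (G3Eq L l) S :=
  .infer (.inl h) (by simpa using ⟨d₁, d₂⟩)

theorem of_ref (t : Tm L 0) (d : Derivable (G3Eq L l) (.eq t t ::ₘ Γ ⇒ Δ)) :
    Derivable (G3Eq L l) (Γ ⇒ Δ) :=
  .infer (.inr (.ref t Γ Δ)) (by simpa using d)

/-- Since `hne` makes the two principal formulas different, their membership provides two separate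
occurrences. -/
theorem of_repl {s r : Tm L 0} {P : Fml L 1} (hP : P.IsAtomic) (h₁ : .eq s r ∈ Γ)
    (h₂ : P.inst s ∈ Γ) (hne : P.inst s ≠ .eq s r)
    (d : Derivable (G3Eq L l) (P.inst r ::ₘ Γ ⇒ Δ)) : Derivable (G3Eq L l) (Γ ⇒ Δ) := by
  obtain ⟨Γ, rfl⟩ := Multiset.exists_cons_of_mem h₁
  obtain ⟨Γ, rfl⟩ := Multiset.exists_cons_of_mem ((Multiset.mem_cons.1 h₂).resolve_left hne)
  refine .infer (.inr (.repl s r P hP Γ Δ)) ?_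
  rw [Multiset.cons_swap, Multiset.cons_swap (P.inst r)] at d
  simpa using d

/-- The rule `Repl` for an equation between terms given by their values at `s` and `r`. -/
theorem of_repl_eq {s r : Tm L 0} (p q : Tm L 1) {p₁ q₁ p₂ q₂ : Tm L 0}
    (hp₁ : p.subst (instSubst s) = p₁) (hq₁ : q.subst (instSubst s) = q₁)
    (hp₂ : p.subst (instSubst r) = p₂) (hq₂ : q.subst (instSubst r) = q₂)
    (h₁ : .eq s r ∈ Γ) (h₂ : .eq p₁ q₁ ∈ Γ) (hne : ¬ (p₁ = s ∧ q₁ = r))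
    (d : Derivable (G3Eq L l) (.eq p₂ q₂ ::ₘ Γ ⇒ Δ)) : Derivable (G3Eq L l) (Γ ⇒ Δ) := by
  subst hp₁ hq₁ hp₂ hq₂
  refine of_repl (P := .eq p q) (.eq _ _) h₁ h₂ (fun h => hne ?_) d
  simpa [Fml.inst_eq, Fml.subst] using h

/-- The instances of `Repl` in which both principal formulas are the same occurrence of an
equation. -/
theorem of_repl_self {s r : Tm L 0} {p q : Tm L 1} (hp : p.subst (instSubst s) = s)
    (hq : q.subst (instSubst s) = r) (h : .eq s r ∈ Γ)
    (d : ∀ Γ', Γ ≤ Γ' → .eq (p.subst (instSubst r)) (q.subst (instSubst r)) ∈ Γ' →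
      Derivable (G3Eq L l) (Γ' ⇒ Δ)) : Derivable (G3Eq L l) (Γ ⇒ Δ) := by
  by_cases hsr : s = r
  · subst hsr
    exact d Γ le_rfl (by rwa [hp, hq])
  have hrs : r ≠ s := fun h => hsr h.symm
  let x : Tm L 1 := FirstOrder.Language.Term.var (.inr 0)
  have hx : ∀ t : Tm L 0, x.subst (instSubst t) = t := fun _ => rfl
  have le : ∀ (A : Fml L 0) (X : Multiset (Fml L 0)), X ≤ A ::ₘ X := fun A X =>
    Multiset.le_cons_self X A
  -- Derive `r = s` first.
  refine of_ref s (of_repl_eq (s := s) (r := r) x (Term.weaken s) (hx _)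
    (Term.weaken_subst _ _) (hx _) (Term.weaken_subst _ _) (by simp [h]) (by simp)
    (fun h => hsr h.2) ?_)
  set p' := p.subst (instSubst r)
  set q' := q.subst (instSubst r)
  by_cases hqr : q' = r
  -- The chain is `p' = p'`, then `p' = s` by `r = s` (as `p` is `s` at `s`), then `p' = r` by `s =
  -- r`, which is the goal equation.
  · refine of_ref p' ?_
    refine of_repl_eq (s := r) (r := s) (Term.weaken p') p (Term.weaken_subst _ _) rfl
      (Term.weaken_subst _ _) hp (by simp) (by simp [p'])
      (fun h => hrs (h.1.symm.trans h.2)) ?_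
    refine of_repl_eq (s := s) (r := r) (Term.weaken p') x (Term.weaken_subst _ _) (hx _)
      (Term.weaken_subst _ _) (hx _) (by simp [h]) (by simp) (fun h => hsr h.2) ?_
    refine d _ ?_ (by simp [hqr])
    exact (le _ _).trans <| (le _ _).trans <| (le _ _).trans <| (le _ _).trans (le _ _)
  -- It suffices to reach `s = q'`: replacing along `p`, `s = r` turns it into `p' = q'`. It differs
  -- from `s = r` because `q' ≠ r`.
  · have k : ∀ Γ', Γ ≤ Γ' → .eq s q' ∈ Γ' → Derivable (G3Eq L l) (Γ' ⇒ Δ) := by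
      intro Γ' hle hm
      refine of_repl_eq (s := s) (r := r) p (Term.weaken q') hp (Term.weaken_subst _ _)
        rfl (Term.weaken_subst _ _) (Multiset.mem_of_le hle h) hm (fun h => hqr h.2) ?_
      exact d _ (hle.trans (le _ _)) (by simp [p'])
    refine of_ref q' ?_
    by_cases hqs : q' = s
    · exact k _ ((le _ _).trans <| (le _ _).trans (le _ _)) (by simp [hqs])
    -- From `q' = q'`, the equation `r = s` gives `r = q'` by replacing along `q`, and then `s =
    -- q'`.
    refine of_repl_eq (s := r) (r := s) q (Term.weaken q') rfl (Term.weaken_subst _ _)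
      hq (Term.weaken_subst _ _) (by simp) (by simp [q']) (fun h => hqr h.1) ?_
    refine of_repl_eq (s := r) (r := s) x (Term.weaken q') (hx _) (Term.weaken_subst _ _)
      (hx _) (Term.weaken_subst _ _) (by simp) (by simp) (fun h => hqs h.2) ?_
    refine k _ ?_ (by simp)
    exact (le _ _).trans <| (le _ _).trans <| (le _ _).trans <| (le _ _).trans (le _ _)

end Derivable

/-- A sequent that covers a derivable set sequent is derivable. -/
theorem CDer.derivable_of_covers {l : Logic} {Γ Δ : Set (Fml L 0)} (d : CDer l Γ Δ)
    {Γ' Δ' : Multiset (Fml L 0)} (h : Covers l Γ' Δ' Γ Δ) :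
    Derivable (G3Eq L l) (Γ' ⇒ Δ') := by
  open Multiset Derivable in
  induction d generalizing Γ' Δ' with
  | init P hP h₁ h₂ =>
    obtain ⟨Γ', rfl⟩ := exists_cons_of_mem ((h.1 P h₁).mem_ant (.inl hP))
    obtain ⟨Δ', rfl⟩ := exists_cons_of_mem ((h.2 P h₂).mem_suc (.inl hP))
    exact rule₀ (.init l P hP _ _)
  | botInit h₁ h₂ =>
    obtain ⟨Γ', rfl⟩ := exists_cons_of_mem ((h.1 _ h₁).mem_ant (.inr rfl))
    by_cases hl : l = .m
    · obtain ⟨Δ', rfl⟩ := exists_cons_of_mem ((h.2 _ (h₂ hl)).mem_suc (.inr rfl))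
      subst hl
      exact rule₀ (.botInit _ _)
    · exact rule₀ (.botL l hl _ _)
  | andL A B hm _ ih =>
    cases h.1 _ hm with
    -- The rule consumes an actual occurrence; its components in the premiss still cover it, so the
    -- induction hypothesis applies although the set premiss retains it.
    | memL hm =>
      obtain ⟨Γ', rfl⟩ := exists_cons_of_mem hm
      refine rule₁ (.andL l A B _ _) (ih (.insL (.headL _) (.insL (.consL _ (.headL _)) ?_)))
      exact h.replaceL ((le_cons_self _ _).trans (le_cons_self _ _)) le_rfl
        (.andL (.headL _) (.consL _ (.headL _)))
    -- The formula was decomposed lower down: its components are covered already, and the inference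
    -- is skipped.
    | andL h₁ h₂ => exact ih (.insL h₁ (.insL h₂ h))
  | andR A B hm _ _ ih₁ ih₂ =>
    cases h.2 _ hm with
    | memR hm =>
      obtain ⟨Δ', rfl⟩ := exists_cons_of_mem hm
      exact rule₂ (.andR l A B _ _)
        (ih₁ (.insR (.headR _) (h.replaceR le_rfl (le_cons_self _ _) (.andR₁ (.headR _)))))
        (ih₂ (.insR (.headR _) (h.replaceR le_rfl (le_cons_self _ _) (.andR₂ (.headR _)))))
    | andR₁ h₁ => exact ih₁ (.insR h₁ h)
    | andR₂ h₂ => exact ih₂ (.insR h₂ h)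
  | orL A B hm _ _ ih₁ ih₂ =>
    cases h.1 _ hm with
    | memL hm =>
      obtain ⟨Γ', rfl⟩ := exists_cons_of_mem hm
      exact rule₂ (.orL l A B _ _)
        (ih₁ (.insL (.headL _) (h.replaceL (le_cons_self _ _) le_rfl (.orL₁ (.headL _)))))
        (ih₂ (.insL (.headL _) (h.replaceL (le_cons_self _ _) le_rfl (.orL₂ (.headL _)))))
    | orL₁ h₁ => exact ih₁ (.insL h₁ h)
    | orL₂ h₂ => exact ih₂ (.insL h₂ h)
  | orR A B hm _ ih =>
    cases h.2 _ hm with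
    | memR hm =>
      obtain ⟨Δ', rfl⟩ := exists_cons_of_mem hm
      refine rule₁ (.orR l A B _ _) (ih (.insR (.headR _) (.insR (.consR _ (.headR _)) ?_)))
      exact h.replaceR le_rfl ((le_cons_self _ _).trans (le_cons_self _ _))
        (.orR (.headR _) (.consR _ (.headR _)))
    | orR h₁ h₂ => exact ih (.insR h₁ (.insR h₂ h))
  | impL A B hm _ _ ih₁ ih₂ =>
    cases h.1 _ hm with
    | memL hm =>
      obtain ⟨Γ', rfl⟩ := exists_cons_of_mem hm
      have e₂ : Derivable (G3Eq L l) (B ::ₘ Γ' ⇒ Δ') :=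
        ih₂ (.insL (.headL _) (h.replaceL (le_cons_self _ _) le_rfl (.impL₂ (.headL _))))
      by_cases hl : l = .c
      · subst hl
        exact rule₂ (.impL A B _ _) (ih₁ (.insR (.headR _)
          (h.replaceL le_rfl (le_cons_self _ _) (.impL₁ rfl (.headR _))))) e₂
      · exact rule₂ (.impLi l hl A B _ _) (ih₁ (.insR (.headR _) (h.consR _))) e₂
    | impL₁ _ h₁ => exact ih₁ (.insR h₁ h)
    | impL₂ h₂ => exact ih₂ (.insL h₂ h)
  | impR A B hm _ ih =>
    cases h.2 _ hm with
    | memR hm =>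
      obtain ⟨Δ', rfl⟩ := exists_cons_of_mem hm
      by_cases hl : l = .c
      · subst hl
        rw [keep_classical] at ih
        exact rule₁ (.impR A B _ _) (ih (.insL (.headL _) (.insR (.headR _)
          (h.replaceR (le_cons_self _ _) (le_cons_self _ _)
            (.impR rfl (.headL _) (.headR _))))))
      · exact rule₁ (.impRi l hl A B _ _) (ih (.insL (.headL _) (.insR (.headR _)
          ((h.consL A).keep_of_ne hl))))
    | impR hl h₁ h₂ =>
      subst hl
      rw [keep_classical] at ih
      exact ih (.insL h₁ (.insR h₂ h))
  | allL A t hm _ ih =>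
    cases h.1 _ hm with
    | memL hm =>
      obtain ⟨Γ', rfl⟩ := exists_cons_of_mem hm
      exact rule₁ (.allL l A t _ _) (ih (.insL (.headL _) (h.consL _)))
  | allR A hm _ ih =>
    cases h.2 _ hm with
    | memR hm =>
      obtain ⟨Δ', rfl⟩ := exists_cons_of_mem hm
      -- Of the premisses for all terms only one is used, at a parameter fresh for this finite
      -- sequent.
      obtain ⟨a, ha⟩ := exists_fresh (Γ' ⇒ .all A ::ₘ Δ')
      by_cases hl : l = .c
      · subst hl
        simp only [keep_classical] at ih
        exact rule₁ (.allR A a _ _ ha) (ih (par a) (.insR (.headR _)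
          (h.replaceR le_rfl (le_cons_self _ _) (.allR rfl (par a) (.headR _)))))
      · exact rule₁ (.allRi l hl A a _ _ ha) (ih (par a) (.insR (.headR _) (h.keep_of_ne hl)))
    | allR hl t h₁ =>
      subst hl
      simp only [keep_classical] at ih
      exact ih t (.insR h₁ h)
  | exL A hm _ ih =>
    cases h.1 _ hm with
    | memL hm =>
      obtain ⟨Γ', rfl⟩ := exists_cons_of_mem hm
      obtain ⟨a, ha⟩ := exists_fresh (.ex A ::ₘ Γ' ⇒ Δ')
      exact rule₁ (.exL l A a _ _ ha) (ih (par a) (.insL (.headL _)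
        (h.replaceL (le_cons_self _ _) le_rfl (.exL (par a) (.headL _)))))
    | exL t h₁ => exact ih t (.insL h₁ h)
  | exR A t hm _ ih =>
    cases h.2 _ hm with
    | memR hm =>
      obtain ⟨Δ', rfl⟩ := exists_cons_of_mem hm
      exact rule₁ (.exR l A t _ _) (ih (.insR (.headR _) (h.consR _)))
  | ref t _ ih => exact of_ref t (ih (.insL (.headL _) (h.consL _)))
  | repl s r P hP h₁ h₂ _ ih =>
    have m₁ := (h.1 _ h₁).mem_ant (.inl (.eq _ _))
    have m₂ := (h.1 _ h₂).mem_ant (.inl (hP.subst _))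
    -- If the two principal formulas coincide, the multiset may hold just one occurrence, too few
    -- for `Repl`.
    by_cases hne : P.inst s = .eq s r
    · cases hP with
      | rel => simp [Fml.inst, Fml.subst] at hne
      | eq p q =>
        simp only [Fml.inst_eq, Fml.subst, Fml.eq.injEq] at hne
        refine of_repl_self hne.1 hne.2 m₁ fun Γ'' hle hmem => ?_
        exact ih (.insL (.memL hmem)
          (h.trans ⟨fun A hA => .memL (mem_of_le hle hA), fun A hA => .memR hA⟩))
    · exact of_repl hP m₁ m₂ hne (ih (.insL (.headL _) (h.consL _)))

/-! ### Equivalence of the calculi and the structural rules -/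

theorem derivable_iff_cder {l : Logic} {Γ Δ : Multiset (Fml L 0)} :
    Derivable (G3Eq L l) (Γ ⇒ Δ) ↔ CDer l {A | A ∈ Γ} {A | A ∈ Δ} :=
  ⟨CDer.of_derivable, fun d => d.derivable_of_covers .refl⟩

/-- Multiset `⊆` ignores multiplicity, so this covers weakening and contraction alike. -/
theorem Derivable.mono {l : Logic} {Γ Δ Γ' Δ' : Multiset (Fml L 0)}
    (d : Derivable (G3Eq L l) (Γ ⇒ Δ)) (hΓ : Γ ⊆ Γ') (hΔ : Δ ⊆ Δ') :
    Derivable (G3Eq L l) (Γ' ⇒ Δ') :=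
  derivable_iff_cder.2 ((derivable_iff_cder.1 d).mono hΓ hΔ)

theorem Derivable.cut {l : Logic} {A : Fml L 0} {Γ Δ Λ Θ : Multiset (Fml L 0)}
    (d₁ : Derivable (G3Eq L l) (Γ ⇒ A ::ₘ Δ)) (d₂ : Derivable (G3Eq L l) (A ::ₘ Λ ⇒ Θ)) :
    Derivable (G3Eq L l) (Γ + Λ ⇒ Δ + Θ) := by
  rw [derivable_iff_cder] at *
  refine CDer.cut A (d₁.mono ?_ ?_) (d₂.mono ?_ ?_) <;> intro B hB <;>
    simp only [Set.mem_ofPred_eq, Multiset.mem_cons, Multiset.mem_add, Set.mem_insert_iff]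
      at hB ⊢ <;> tauto

end G3

theorem mainTheorem4 (L : FirstOrder.Language.{u, v}) (l : G3.Logic) :
    G3.Admissible (G3.G3Eq L l) (G3.LW L) ∧
    G3.Admissible (G3.G3Eq L l) (G3.RW L) ∧
    G3.Admissible (G3.G3Eq L l) (G3.LC L) ∧
    G3.Admissible (G3.G3Eq L l) (G3.RC L) ∧
    G3.Admissible (G3.G3Eq L l) (G3.Cut L) := by
  refine ⟨?_, ?_, ?_, ?_, ?_⟩ <;> rintro _ _ ⟨⟩ d <;>
    simp only [List.mem_cons, List.not_mem_nil, or_false, forall_eq_or_imp, forall_eq] at d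
  · exact d.mono (Multiset.subset_cons _ _) (Multiset.Subset.refl _)
  · exact d.mono (Multiset.Subset.refl _) (Multiset.subset_cons _ _)
  · exact d.mono (by simp) (Multiset.Subset.refl _)
  · exact d.mono (Multiset.Subset.refl _) (by simp)
  · exact d.1.cut d.2
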